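/- Conventions. A tree $T$ is a non-empty connected graph without circuits, with vertex set $V(T)$ and combinatorial distance $d$. A ray in $T$ is a sequence $(x_n)_{n\ge 0}$ of vertices with $d(x_m,x_n)=|m-n|$ for all $m,n$; rays $(x_n)$ and $(y_n)$ are cofinal if for some $k\in\mathbf Z$ one has $y_n=x_{n+k}$ for all large $n$; the boundary $\partial T$ is the set of cofinality classes of rays, with the topology generated by the shadows of the oriented edges $e$ from $s(e)$ to $t(e)$, the shadow of $e$ being the set of classes represented by rays $(x_n)$ such that $d(t(e),x_n)<d(s(e),x_n)$ for all large $n$. An automorphism $\gamma$ of $T$ is hyperbolic if it does not exchange the two endpoints of any edge and $\min_{y\in V(T)}d(y,\gamma(y))\ge 1$. An action of a group $\Gamma$ on $T$ by automorphisms is - slender if, for every $\gamma\in\Gamma$ with $\gamma\neq 1$, the fixed point set of $\gamma$ in $\partial T$ has empty interior; - strongly hyperbolic if there are two elements of $\Gamma$ which act as hyperbolic automorphisms and which are transverse, that is, have no common fixed point in $\partial T$; - minimal if there is no proper $\Gamma$-invariant (non-empty) subtree of $T$. A group $G$ is a Powers group if $G\neq\{1\}$ and if, for every finite subset $F\subset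 G\smallsetminus\{1\}$ and every integer $N\ge 1$, there exist a partition $G=C\sqcup D$ and elements $\gamma_1,\dots,\gamma_N\in G$ such that $fC\cap C=\emptyset$ for all $f\in F$ and $\gamma_jD\cap\gamma_kD=\emptyset$ for all $j\neq k$. A group $\Gamma$ is a strongly Powers group if every subnormal subgroup $N\neq\{1\}$ of $\Gamma$ is a Powers group; here $N$ is subnormal in $\Gamma$ if there is a finite chain $N=N_0\le N_1\le\cdots\le N_k=\Gamma$ with $N_{j-1}$ normal in $N_j$ for $j=1,\dots,k$. **Proposition.** Let $\Gamma$ be a countable group which acts by automorphisms on a tree $T$. Assume that the action is slender, strongly hyperbolic, and minimal. Then $\Gamma$ is a strongly Powers group. -/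

import Mathlib

namespace TreeAction

section Boundary

/-- A ray in `T`: a sequence of vertices `x₀, x₁, x₂, …` with `d(x_m, x_n) = |m - n|`. -/
structure Ray {V : Type*} (T : SimpleGraph V) where
  vertex : ℕ → V
  dist_eq : ∀ m n : ℕ, (T.dist (vertex m) (vertex n) : ℤ) = |(m : ℤ) - (n : ℤ)|

/-- Two rays are cofinal if they agree eventually up to a shift `k ∈ ℤ` of the indices (the shift
is written as a difference `l' - l` of natural numbers). -/
def Ray.Cofinal {V : Type*} {T : SimpleGraph V} (x y : Ray T) : Prop :=
  ∃ l l' : ℕ, ∀ n : ℕ, y.vertex (n + l) = x.vertex (n + l')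

theorem Ray.Cofinal.equivalence {V : Type*} (T : SimpleGraph V) :
    Equivalence (Ray.Cofinal : Ray T → Ray T → Prop) where
  refl _ := ⟨0, 0, fun _ => rfl⟩
  symm := fun ⟨l, l', h⟩ => ⟨l', l, fun n => (h n).symm⟩
  trans := by
    rintro x y z ⟨a, b, h⟩ ⟨c, d, h'⟩
    refine ⟨c + a, b + d, fun n => ?_⟩
    have e1 := h' (n + a)
    have e2 := h (n + d)
    have i1 : n + (c + a) = n + a + c := by omega
    have i2 : n + a + d = n + d + a := by omega
    have i3 : n + (b + d) = n + d + b := by omega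
    rw [i1, e1, i2, e2, i3]

instance raySetoid {V : Type*} (T : SimpleGraph V) : Setoid (Ray T) where
  r := Ray.Cofinal
  iseqv := Ray.Cofinal.equivalence T

/-- The boundary `∂T`: the set of cofinal classes of rays. -/
def Boundary {V : Type*} (T : SimpleGraph V) : Type _ :=
  Quotient (raySetoid T)

/-- The boundary point represented by a ray. -/
def Ray.toBoundary {V : Type*} {T : SimpleGraph V} (x : Ray T) : Boundary T :=
  Quotient.mk (raySetoid T) x

/-- The shadow in `∂T` of an oriented edge `e` with source `e.fst` and terminus `e.snd`: the
boundary points represented by rays that are eventually closer to the terminus. -/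
def shadow {V : Type*} {T : SimpleGraph V} (e : T.Dart) : Set (Boundary T) :=
  {ξ | ∃ x : Ray T, x.toBoundary = ξ ∧
    ∀ᶠ n in Filter.atTop, T.dist e.snd (x.vertex n) < T.dist e.fst (x.vertex n)}

/-- The shadow topology on `∂T`: the topology generated by the shadows. -/
instance boundaryTopology {V : Type*} (T : SimpleGraph V) : TopologicalSpace (Boundary T) :=
  TopologicalSpace.generateFrom (Set.range (shadow : T.Dart → Set (Boundary T)))

theorem dist_iso {V : Type*} {T : SimpleGraph V} (φ : T ≃g T) (u v : V) :
    T.dist (φ u) (φ v) = T.dist u v := by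
  have edist_le (ψ : T ≃g T) (u v : V) : T.edist (ψ u) (ψ v) ≤ T.edist u v := by
    refine le_iInf fun p => ?_
    have h := (p.map ψ.toHom).edist_le
    rw [SimpleGraph.Walk.length_map] at h
    exact h
  have h : T.edist (φ u) (φ v) = T.edist u v := by
    refine le_antisymm (edist_le φ u v) ?_
    have h' := edist_le φ.symm (φ u) (φ v)
    rwa [RelIso.symm_apply_apply, RelIso.symm_apply_apply] at h'
  unfold SimpleGraph.dist
  rw [h]

/-- The image of a ray under an automorphism. -/
def Ray.map {V : Type*} {T : SimpleGraph V} (φ : T ≃g T) (x : Ray T) : Ray T where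
  vertex n := φ (x.vertex n)
  dist_eq m n := by rw [dist_iso]; exact x.dist_eq m n

/-- The action of an automorphism of `T` on `∂T`. -/
def boundaryMap {V : Type*} {T : SimpleGraph V} (φ : T ≃g T) : Boundary T → Boundary T :=
  Quotient.map (Ray.map φ) fun _ _ ⟨l, l', h⟩ => ⟨l, l', fun n => congrArg φ (h n)⟩

/-- The fixed point set of an automorphism of `T` in `∂T`. -/
def boundaryFixedPoints {V : Type*} {T : SimpleGraph V} (φ : T ≃g T) : Set (Boundary T) :=
  {ξ | boundaryMap φ ξ = ξ}

end Boundary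

section Automorphisms

/-- An automorphism is an inversion if it reverses some edge. -/
def IsInversion {V : Type*} {T : SimpleGraph V} (φ : T ≃g T) : Prop :=
  ∃ x y : V, T.Adj x y ∧ φ x = y ∧ φ y = x

/-- `min {d(y, φ y) | y ∈ V(T)}`. -/
noncomputable def translationLength {V : Type*} {T : SimpleGraph V} (φ : T ≃g T) : ℕ :=
  sInf (Set.range fun y : V => T.dist y (φ y))

/-- An automorphism is hyperbolic if it is not an inversion and has translation length `≥ 1`. -/
def IsHyperbolic {V : Type*} {T : SimpleGraph V} (φ : T ≃g T) : Prop :=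
  ¬ IsInversion φ ∧ 1 ≤ translationLength φ

/-- An automorphism is slender if its fixed point set in `∂T` has empty interior. -/
def IsSlender {V : Type*} {T : SimpleGraph V} (φ : T ≃g T) : Prop :=
  interior (boundaryFixedPoints φ) = ∅

end Automorphisms

section Actions

/-- Every element other than `1` acts as a slender automorphism. -/
def IsSlenderAction {V Γ : Type*} [Group Γ] {T : SimpleGraph V} (ρ : Γ →* (T ≃g T)) : Prop :=
  ∀ γ : Γ, γ ≠ 1 → IsSlender (ρ γ)

/-- There are two hyperbolic elements without common fixed point in `∂T`. -/
def IsStronglyHyperbolicAction {V Γ : Type*} [Group Γ] {T : SimpleGraph V}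
    (ρ : Γ →* (T ≃g T)) : Prop :=
  ∃ γ δ : Γ, IsHyperbolic (ρ γ) ∧ IsHyperbolic (ρ δ) ∧
    Disjoint (boundaryFixedPoints (ρ γ)) (boundaryFixedPoints (ρ δ))

/-- There is no proper invariant subtree. (The subtrees of a tree are its connected subgraphs;
`SimpleGraph.Subgraph.Connected` includes non-emptiness.) -/
def IsMinimalAction {V Γ : Type*} [Group Γ] {T : SimpleGraph V} (ρ : Γ →* (T ≃g T)) : Prop :=
  ∀ S : T.Subgraph, S.Connected → (∀ γ : Γ, S.map (ρ γ).toHom = S) → S = ⊤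

end Actions

section Powers

/-- A Powers group: not reduced to one element and, for every finite `F ⊆ Γ ∖ {1}` and `N ≥ 1`,
there are a partition `Γ = C ⊔ D` and `γ₁, …, γ_N ∈ Γ` such that `f C ∩ C = ∅` for `f ∈ F` and
`γ_j D ∩ γ_k D = ∅` for `j ≠ k`. -/
def IsPowersGroup (Γ : Type*) [Group Γ] : Prop :=
  Nontrivial Γ ∧
    ∀ F : Finset Γ, (1 : Γ) ∉ F → ∀ N : ℕ, 1 ≤ N →
      ∃ (C D : Set Γ) (γ : Fin N → Γ), C ∪ D = Set.univ ∧ C ∩ D = ∅ ∧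
        (∀ f ∈ F, ((fun x => f * x) '' C) ∩ C = ∅) ∧
        ∀ j k : Fin N, j ≠ k → ((fun x => γ j * x) '' D) ∩ ((fun x => γ k * x) '' D) = ∅

/-- Every subnormal subgroup other than `{1}` is a Powers group. -/
def IsStronglyPowersGroup (Γ : Type*) [Group Γ] : Prop :=
  ∀ N : Subgroup Γ, N.IsSubnormal → N ≠ ⊥ → IsPowersGroup N

end Powers

end TreeAction

/-!
Fix a vertex `v₀`. For a half-tree `B`, split a subgroup `N` of `Γ` into `C = {g | g v₀ ∈ B}` and
its complement `D`. Then `f C ∩ C = ∅` as soon as `f B ∩ B = ∅`, and the sets `g ^ j D` are pairwise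
disjoint as soon as every positive power of `g ∈ N` sends the complement of `B` into `B`
(`ContractsInto`). So the Powers property of `N` follows (`isPowersGroup_of_contractsInto`) from two
facts.

* For a finite set `F` of non-trivial elements there is a half-tree `B`, with non-empty shadow, moved
  off itself by all of `F` (`IsSlenderAction.exists_halfTree`). By slenderness a non-empty shadow
  contains a boundary point which a given `f ≠ 1` does not fix, and small half-trees around this
  point and its image are disjoint (`Ray.exists_disjoint_halfTree`). The elements of `F` are treated
  one after the other, so that no Baire category argument is needed.
* Every non-trivial subnormal `N` contracts into every half-tree with non-empty shadow
  (`contractsInto_of_isSubnormal`). For `N = Γ` (`contractsInto_halfTree`), a hyperbolic `δ`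
  contracts into a union of neighbourhoods of its two ends; a transverse hyperbolic `γ` pushes this
  union towards either end of its axis, and by minimality a translate of one of these ends lies in
  `B`. The property passes from `K` to a normal subgroup `H` (`ContractsInto.of_normal`): choose
  `n ∈ H`, `n ≠ 1`, and shrink `B` so that `n B ∩ B = ∅`. If `m ∈ K` contracts into `B`, then so
  does `m n m⁻² n⁻¹ m`, which is in `H` since its exponent sum in `m` is zero.
-/

namespace TreeAction

open SimpleGraph

/-! ### Half-trees -/

/-- The half-tree of the oriented edge from `s` to `t`: the vertices closer to `t` than to `s`. -/
def halfTree {V : Type*} (T : SimpleGraph V) (s t : V) : Set V :=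
  {v | T.dist t v < T.dist s v}

section Tree

variable {V : Type*} {T : SimpleGraph V}

theorem apply_mem_halfTree_iff (φ : T ≃g T) {s t v : V} :
    φ v ∈ halfTree T (φ s) (φ t) ↔ v ∈ halfTree T s t := by
  simp only [halfTree, Set.mem_ofPred_eq, dist_iso]

theorem exists_adj_dist_eq (hT : T.IsTree) {r v : V} (h : v ≠ r) :
    ∃ u, T.Adj v u ∧ T.dist r v = T.dist r u + 1 := by
  obtain ⟨p, hp⟩ := hT.connected.exists_walk_length_eq_dist v r
  cases p with
  | nil => exact absurd rfl h
  | @cons _ u _ hadj q =>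
    refine ⟨u, hadj, ?_⟩
    have h1 := dist_le q
    rw [Walk.length_cons] at hp
    rcases hT.dist_eq_dist_add_one_of_adj r hadj with h2 | h2
    · exact h2
    · rw [T.dist_comm (u := u)] at h1
      rw [T.dist_comm] at hp
      omega

theorem eq_of_dist_eq (hT : T.IsTree) {r v u w : V} (hu : T.Adj v u) (hw : T.Adj v w)
    (hdu : T.dist r v = T.dist r u + 1) (hdw : T.dist r v = T.dist r w + 1) : u = w := by
  obtain ⟨p, hp⟩ := hT.connected.exists_walk_length_eq_dist r u
  obtain ⟨q, hq⟩ := hT.connected.exists_walk_length_eq_dist r w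
  have hp' : (p.concat hu.symm).IsPath :=
    Walk.isPath_of_length_eq_dist _ (by rw [Walk.length_concat, hp, hdu])
  have hq' : (q.concat hw.symm).IsPath :=
    Walk.isPath_of_length_eq_dist _ (by rw [Walk.length_concat, hq, hdw])
  have h := congrArg Subtype.val ((hT.isAcyclic.subsingleton_path _ _).elim ⟨_, hp'⟩ ⟨_, hq'⟩)
  have h' := congrArg Walk.penultimate h
  simpa using h'

theorem dist_triangle_adj (hT : T.IsTree) {u v : V} (h : T.Adj u v) (r : V) :
    T.dist r u ≤ T.dist r v + 1 := by
  rcases hT.dist_eq_dist_add_one_of_adj r h with h | h <;> omega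

theorem snd_mem_halfTree {s t : V} (h : T.Adj s t) : t ∈ halfTree T s t := by
  simp [halfTree, dist_eq_one_iff_adj.2 h]

theorem notMem_halfTree_iff (hT : T.IsTree) {s t v : V} (h : T.Adj s t) :
    v ∉ halfTree T s t ↔ v ∈ halfTree T t s := by
  have := hT.dist_eq_dist_add_one_of_adj v h
  rw [T.dist_comm (u := v), T.dist_comm (u := v)] at this
  simp only [halfTree, Set.mem_ofPred_eq]
  omega

/-- The only edge joining a half-tree to its complement is the edge which defines it. -/
theorem eq_of_adj_of_mem_halfTree (hT : T.IsTree) {s t u v : V} (hst : T.Adj s t)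
    (huv : T.Adj u v) (hu : u ∈ halfTree T s t) (hv : v ∉ halfTree T s t) : u = t ∧ v = s := by
  have hv' := (notMem_halfTree_iff hT hst).1 hv
  simp only [halfTree, Set.mem_ofPred_eq] at hu hv'
  have a1 := dist_triangle_adj hT hst u
  have a2 := dist_triangle_adj hT hst.symm v
  have a3 := dist_triangle_adj hT huv s
  have a4 := dist_triangle_adj hT huv.symm t
  rw [T.dist_comm (u := u), T.dist_comm (u := u)] at a1
  rw [T.dist_comm (u := v), T.dist_comm (u := v)] at a2
  have hut : u = t := by
    by_contra hne
    obtain ⟨w, hw, hd⟩ := exists_adj_dist_eq hT hne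
    have b1 := dist_triangle_adj hT hst w
    rw [T.dist_comm (u := w), T.dist_comm (u := w)] at b1
    have b2 := dist_triangle_adj hT hw s
    have : w = v := eq_of_dist_eq hT (r := s) hw huv (by omega) (by omega)
    subst this
    omega
  subst hut
  refine ⟨rfl, ?_⟩
  have : T.dist s v = 0 := by
    rw [dist_eq_one_iff_adj.2 hst, dist_self] at a1
    have := dist_eq_one_iff_adj.2 hst
    omega
  exact ((hT.connected.dist_eq_zero_iff).1 this).symm

/-- A half-tree which misses an endpoint of an edge is either contained in or disjoint from the
half-tree of that edge. -/
theorem mem_halfTree_iff_of_notMem (hT : T.IsTree) {s t s' t' u : V} (hst : T.Adj s t)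
    (hst' : T.Adj s' t') (hmiss : s ∉ halfTree T s' t' ∨ t ∉ halfTree T s' t')
    (hu : u ∈ halfTree T s' t') : u ∈ halfTree T s t ↔ t' ∈ halfTree T s t := by
  induction hn : T.dist t' u generalizing u with
  | zero =>
    rw [(hT.connected.dist_eq_zero_iff).1 hn]
  | succ n ih =>
    have hne : u ≠ t' := by
      rintro rfl
      simp at hn
    obtain ⟨w, hw, hd⟩ := exists_adj_dist_eq hT hne
    have hw' : w ∈ halfTree T s' t' := by
      have := dist_triangle_adj hT hw s'
      simp only [halfTree, Set.mem_ofPred_eq] at hu ⊢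
      omega
    rw [← ih hw' (by omega)]
    constructor
    · intro h
      by_contra h'
      obtain ⟨rfl, rfl⟩ := eq_of_adj_of_mem_halfTree hT hst hw h h'
      tauto
    · intro h
      by_contra h'
      obtain ⟨rfl, rfl⟩ := eq_of_adj_of_mem_halfTree hT hst hw.symm h h'
      tauto

theorem halfTree_subset_halfTree (hT : T.IsTree) {s t s' t' : V} (hst : T.Adj s t)
    (hst' : T.Adj s' t') (hs : s ∉ halfTree T s' t') (ht' : t' ∈ halfTree T s t) :
    halfTree T s' t' ⊆ halfTree T s t := fun _ hu =>
  (mem_halfTree_iff_of_notMem hT hst hst' (Or.inl hs) hu).2 ht'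

/-- The complement of a half-tree is convex: it contains the neighbour of `u` on the way from `u`
to `p`, if it contains `p` and `u`. -/
theorem notMem_halfTree_of_dist_eq (hT : T.IsTree) {s t p u w : V} (hst : T.Adj s t)
    (hp : p ∉ halfTree T s t) (hu : u ∉ halfTree T s t) (hw : T.Adj u w)
    (hd : T.dist p u = T.dist p w + 1) : w ∉ halfTree T s t := by
  intro h
  obtain ⟨rfl, rfl⟩ := eq_of_adj_of_mem_halfTree hT hst hw.symm h hu
  apply hp
  simp only [halfTree, Set.mem_ofPred_eq]
  rw [T.dist_comm (v := p), T.dist_comm (v := p)]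
  omega

end Tree

/-! ### Rays -/

section Ray

variable {V : Type*} {T : SimpleGraph V}

theorem Ray.adj (x : Ray T) (n : ℕ) : T.Adj (x.vertex n) (x.vertex (n + 1)) := by
  rw [← dist_eq_one_iff_adj]
  have := x.dist_eq n (n + 1)
  push_cast at this
  rw [show (n : ℤ) - (n + 1) = -1 by ring] at this
  simpa using this

theorem Ray.injective (x : Ray T) : Function.Injective x.vertex := by
  intro m n h
  have := x.dist_eq m n
  rw [h, dist_self] at this
  have := abs_eq_zero.1 this.symm
  omega

theorem Ray.mem_halfTree_iff (x : Ray T) {m n : ℕ} :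
    x.vertex m ∈ halfTree T (x.vertex n) (x.vertex (n + 1)) ↔ n < m := by
  have h1 := x.dist_eq n m
  have h2 := x.dist_eq (n + 1) m
  simp only [halfTree, Set.mem_ofPred_eq]
  push_cast at h2
  rcases lt_or_ge n m with h | h
  · rw [abs_of_nonpos (by omega)] at h1 h2
    omega
  · rw [abs_of_nonneg (by omega)] at h1 h2
    omega

theorem Ray.halfTree_antitone (hT : T.IsTree) (x : Ray T) :
    Antitone fun n => halfTree T (x.vertex n) (x.vertex (n + 1)) := by
  intro m n hmn
  rcases hmn.eq_or_lt with rfl | h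
  · exact le_rfl
  · exact halfTree_subset_halfTree hT (x.adj m) (x.adj n)
      (by rw [x.mem_halfTree_iff]; omega) (by rw [x.mem_halfTree_iff]; omega)

theorem Ray.notMem_halfTree (hT : T.IsTree) (x : Ray T) {v : V} {n : ℕ}
    (hn : T.dist (x.vertex 0) v ≤ n) : v ∉ halfTree T (x.vertex n) (x.vertex (n + 1)) := by
  intro hv
  have key : ∀ k ≤ n + 1, T.dist (x.vertex k) v + k ≤ T.dist (x.vertex 0) v := by
    intro k
    induction k with
    | zero => simp
    | succ k ih =>
      intro hk
      have h1 := ih (by omega)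
      have h2 := x.halfTree_antitone hT (show k ≤ n by omega) hv
      simp only [halfTree, Set.mem_ofPred_eq] at h2
      omega
  have := key (n + 1) le_rfl
  omega

/-- Rays with distinct endpoints have disjoint half-trees far out. -/
theorem Ray.exists_disjoint_halfTree (hT : T.IsTree) (x y : Ray T)
    (hxy : x.toBoundary ≠ y.toBoundary) :
    ∃ N, ∀ n ≥ N, Disjoint (halfTree T (x.vertex n) (x.vertex (n + 1)))
      (halfTree T (y.vertex n) (y.vertex (n + 1))) := by
  suffices h : ∃ n, Disjoint (halfTree T (x.vertex n) (x.vertex (n + 1)))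
      (halfTree T (y.vertex n) (y.vertex (n + 1))) by
    obtain ⟨N, hN⟩ := h
    exact ⟨N, fun n hn => hN.mono (x.halfTree_antitone hT hn) (y.halfTree_antitone hT hn)⟩
  by_contra! hcon
  -- The half-trees of `y` miss the `n`-th edge of `x` far out, hence lie in its half-tree.
  have hmem : ∀ n, ∃ m, y.vertex m ∈ halfTree T (x.vertex n) (x.vertex (n + 1)) := by
    intro n
    set m := max n (T.dist (y.vertex 0) (x.vertex n)) with hm
    obtain ⟨v, hvx, hvy⟩ := Set.not_disjoint_iff.1 (hcon m)
    refine ⟨m + 1, (mem_halfTree_iff_of_notMem hT (x.adj n) (y.adj m)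
      (Or.inl (y.notMem_halfTree hT (le_max_right _ _))) hvy).1 ?_⟩
    exact x.halfTree_antitone hT (le_max_left _ _) hvx
  have hcross : ∀ n ≥ T.dist (x.vertex 0) (y.vertex 0),
      ∃ m, y.vertex m = x.vertex n ∧ y.vertex (m + 1) = x.vertex (n + 1) := by
    intro n hn
    classical
    have h0 := x.notMem_halfTree hT hn
    have hpos : Nat.find (hmem n) ≠ 0 := fun h => h0 (h ▸ Nat.find_spec (hmem n))
    obtain ⟨m, hm⟩ := Nat.exists_eq_succ_of_ne_zero hpos
    have h1 : y.vertex (m + 1) ∈ halfTree T (x.vertex n) (x.vertex (n + 1)) := by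
      have := Nat.find_spec (hmem n)
      rwa [hm] at this
    have h2 := Nat.find_min (hmem n) (m := m) (by omega)
    have := eq_of_adj_of_mem_halfTree hT (x.adj n) (y.adj m).symm h1 h2
    exact ⟨m, this.2, this.1⟩
  obtain ⟨m, hm, -⟩ := hcross _ le_rfl
  apply hxy
  refine Quotient.sound ⟨m, T.dist (x.vertex 0) (y.vertex 0), fun n => ?_⟩
  induction n with
  | zero => simpa using hm
  | succ n ih =>
    obtain ⟨l, hl, hl'⟩ := hcross (n + T.dist (x.vertex 0) (y.vertex 0)) (by omega)
    have : l = n + m := y.injective (hl.trans ih.symm)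
    subst this
    rw [show n + 1 + m = n + m + 1 by omega, hl']
    congr 1
    omega

end Ray

/-! ### Axes of hyperbolic automorphisms -/

/-- A bi-infinite geodesic line in `T`. -/
structure Line {V : Type*} (T : SimpleGraph V) where
  vertex : ℤ → V
  dist_eq : ∀ i j : ℤ, (T.dist (vertex i) (vertex j) : ℤ) = |i - j|

section Line

variable {V : Type*} {T : SimpleGraph V}

/-- The line traversed backwards. -/
def Line.reverse (x : Line T) : Line T where
  vertex i := x.vertex (-i)
  dist_eq i j := by rw [x.dist_eq, abs_sub_comm]; congr 1; ring

/-- The positive half of a line. -/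
def Line.toRay (x : Line T) : Ray T where
  vertex n := x.vertex n
  dist_eq m n := x.dist_eq m n

theorem Line.adj (x : Line T) (i : ℤ) : T.Adj (x.vertex i) (x.vertex (i + 1)) := by
  rw [← dist_eq_one_iff_adj]
  have := x.dist_eq i (i + 1)
  rw [show i - (i + 1) = -1 by ring] at this
  simpa using this

theorem Line.mem_halfTree_iff (x : Line T) {i j : ℤ} :
    x.vertex j ∈ halfTree T (x.vertex i) (x.vertex (i + 1)) ↔ i < j := by
  have h1 := x.dist_eq i j
  have h2 := x.dist_eq (i + 1) j
  simp only [halfTree, Set.mem_ofPred_eq]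
  rcases lt_or_ge i j with h | h
  · rw [abs_of_nonpos (by omega)] at h1 h2
    omega
  · rw [abs_of_nonneg (by omega)] at h1 h2
    omega

theorem Line.halfTree_antitone (hT : T.IsTree) (x : Line T) :
    Antitone fun i => halfTree T (x.vertex i) (x.vertex (i + 1)) := by
  intro i j hij
  rcases hij.eq_or_lt with rfl | h
  · exact le_rfl
  · exact halfTree_subset_halfTree hT (x.adj i) (x.adj j)
      (by rw [x.mem_halfTree_iff]; omega) (by rw [x.mem_halfTree_iff]; omega)

/-- In a tree, a path without backtracking is geodesic. -/
theorem dist_eq_of_forall_ne (hT : T.IsTree) {x : ℕ → V} (hadj : ∀ n, T.Adj (x n) (x (n + 1)))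
    (hne : ∀ n, x n ≠ x (n + 2)) (n : ℕ) : T.dist (x 0) (x n) = n := by
  suffices h : T.dist (x 0) (x n) = n ∧ T.dist (x 0) (x (n + 1)) = n + 1 from h.1
  induction n with
  | zero => exact ⟨by simp, by simpa using hadj 0⟩
  | succ n ih =>
    refine ⟨ih.2, ?_⟩
    rcases hT.dist_eq_dist_add_one_of_adj (x 0) (hadj (n + 1)) with h | h
    · exact absurd (eq_of_dist_eq hT (hadj n).symm (hadj (n + 1)) (by omega) h) (hne n)
    · rw [h, ih.2]

/-- A hyperbolic automorphism translates a line by a positive amount. -/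
theorem IsHyperbolic.exists_line (hT : T.IsTree) {φ : T ≃g T} (hφ : IsHyperbolic φ) :
    ∃ (x : Line T) (l : ℤ), 1 ≤ l ∧ ∀ i, φ (x.vertex i) = x.vertex (i + l) := by
  obtain ⟨hinv, hl⟩ := hφ
  set l := translationLength φ with hldef
  have hmin : ∀ v, l ≤ T.dist v (φ v) := fun v => Nat.sInf_le ⟨v, rfl⟩
  have := hT.connected.nonempty
  obtain ⟨v, hv⟩ : l ∈ Set.range fun y : V => T.dist y (φ y) :=
    Nat.sInf_mem (Set.range_nonempty _)
  obtain ⟨p, hp⟩ := hT.connected.exists_walk_length_eq_dist v (φ v)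
  have hpl : p.length = l := hp.trans hv
  have hl0 : (l : ℤ) ≠ 0 := by omega
  -- The translates of a geodesic from `v` to `φ v` are put end to end.
  let x : ℤ → V := fun i => (φ ^ (i / (l : ℤ))) (p.getVert (i % (l : ℤ)).toNat)
  have hx : ∀ i, φ (x i) = x (i + l) := by
    intro i
    simp only [x, Int.add_emod_right, Int.add_ediv_of_dvd_right (dvd_refl (l : ℤ)),
      Int.ediv_self hl0]
    rw [add_comm, zpow_add, zpow_one, RelIso.mul_apply]
  have hsucc : ∀ i, x (i + 1) = (φ ^ (i / (l : ℤ))) (p.getVert ((i % (l : ℤ)).toNat + 1)) := by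
    intro i
    have h1 := Int.emod_nonneg i hl0
    have h2 := Int.emod_lt_of_pos i (show (0 : ℤ) < l by omega)
    have h3 := Int.emod_add_mul_ediv i l
    by_cases h : i % (l : ℤ) + 1 = l
    · have hd : (i + 1) / (l : ℤ) = i / l + 1 := by
        rw [show i + 1 = (i / l + 1) * l by linear_combination -h3 + h]
        exact Int.mul_ediv_cancel _ hl0
      have hm : (i + 1) % (l : ℤ) = 0 := by
        rw [show i + 1 = (i / l + 1) * l by linear_combination -h3 + h]
        exact Int.mul_emod_left _ _
      have : (i % (l : ℤ)).toNat + 1 = p.length := by omega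
      simp only [x, hd, hm, this, Int.toNat_zero, Walk.getVert_zero, Walk.getVert_length]
      rw [zpow_add, zpow_one, RelIso.mul_apply]
    · have hd : (i + 1) / (l : ℤ) = i / l := by
        rw [show i + 1 = (i % l + 1) + (i / l) * l by linear_combination -h3,
          Int.add_mul_ediv_right _ _ hl0, Int.ediv_eq_zero_of_lt (by omega) (by omega), zero_add]
      have hm : (i + 1) % (l : ℤ) = i % l + 1 := by
        rw [show i + 1 = (i % l + 1) + (i / l) * l by linear_combination -h3,
          Int.add_mul_emod_self_right, Int.emod_eq_of_lt (by omega) (by omega)]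
      have : (i % (l : ℤ) + 1).toNat = (i % (l : ℤ)).toNat + 1 := by omega
      simp only [x, hd, hm, this]
  have hadj : ∀ i, T.Adj (x i) (x (i + 1)) := by
    intro i
    rw [hsucc]
    refine (φ ^ (i / (l : ℤ))).map_adj_iff.2 (p.adj_getVert_succ ?_)
    have := Int.emod_lt_of_pos i (show (0 : ℤ) < l by omega)
    have := Int.emod_nonneg i hl0
    omega
  have hle : ∀ i (n : ℕ), T.dist (x i) (x (i + n)) ≤ n := by
    intro i n
    induction n with
    | zero => simp
    | succ n ih =>
      have := dist_triangle_adj hT (hadj (i + n)).symm (x i)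
      push_cast
      rw [← add_assoc]
      omega
  -- A backtracking would produce a shorter displacement, or an inversion if `l = 1`.
  have hne : ∀ i, x i ≠ x (i + 2) := by
    intro i h
    by_cases h1 : l = 1
    · apply hinv
      refine ⟨x i, x (i + 1), hadj i, ?_, ?_⟩
      · rw [hx, h1, Nat.cast_one]
      · rw [hx, h1, h, Nat.cast_one, add_assoc]; rfl
    · have h2 := hmin (x i)
      have h3 := hle (i + 2) (l - 2)
      rw [← h, show i + 2 + ((l - 2 : ℕ) : ℤ) = i + l by omega, ← hx] at h3
      omega
  have hdist : ∀ i (n : ℕ), T.dist (x i) (x (i + n)) = n := by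
    intro i n
    have := dist_eq_of_forall_ne hT (x := fun n : ℕ => x (i + n))
      (fun n => by have := hadj (i + n); push_cast; rwa [← add_assoc])
      (fun n => by have := hne (i + n); push_cast; rwa [← add_assoc]) n
    simpa using this
  refine ⟨⟨x, fun i j => ?_⟩, l, by omega, hx⟩
  rcases le_total i j with h | h
  · obtain ⟨n, rfl⟩ := Int.le.dest h
    rw [hdist]
    simp
  · obtain ⟨n, rfl⟩ := Int.le.dest h
    rw [T.dist_comm, hdist]
    simp

theorem Line.reverse_apply {x : Line T} {φ : T ≃g T} {l : ℤ}
    (hx : ∀ i, φ (x.vertex i) = x.vertex (i + l)) (i : ℤ) :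
    φ⁻¹ (x.reverse.vertex i) = x.reverse.vertex (i + l) := by
  have h := hx (-(i + l))
  rw [show -(i + l) + l = -i by ring] at h
  change φ⁻¹ (x.vertex (-i)) = x.vertex (-(i + l))
  rw [← h]
  exact RelIso.inv_apply_self φ _

theorem Line.pow_apply {x : Line T} {φ : T ≃g T} {l : ℤ}
    (hx : ∀ i, φ (x.vertex i) = x.vertex (i + l)) (k : ℕ) (i : ℤ) :
    (φ ^ k) (x.vertex i) = x.vertex (i + k * l) := by
  induction k with
  | zero => simp
  | succ k ih =>
    rw [pow_succ', RelIso.mul_apply, ih, hx]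
    congr 1
    push_cast
    ring

/-- The powers of a translation of a line push the half-trees of the line along it. -/
theorem Line.pow_apply_mem_halfTree (hT : T.IsTree) {x : Line T} {φ : T ≃g T} {l : ℤ} (hl : 1 ≤ l)
    (hx : ∀ i, φ (x.vertex i) = x.vertex (i + l)) {i j : ℤ} {k : ℕ} (hk : j ≤ i + k) {v : V}
    (hv : v ∈ halfTree T (x.vertex i) (x.vertex (i + 1))) :
    (φ ^ k) v ∈ halfTree T (x.vertex j) (x.vertex (j + 1)) := by
  rw [← apply_mem_halfTree_iff (φ ^ k), pow_apply hx, pow_apply hx,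
    show i + 1 + k * l = (i + k * l) + 1 by ring] at hv
  exact x.halfTree_antitone hT (by nlinarith) hv

theorem Line.toBoundary_mem_boundaryFixedPoints {x : Line T} {φ : T ≃g T} {l : ℤ} (hl : 1 ≤ l)
    (hx : ∀ i, φ (x.vertex i) = x.vertex (i + l)) :
    x.toRay.toBoundary ∈ boundaryFixedPoints φ := by
  refine Quotient.sound ⟨l.toNat, 0, fun n => ?_⟩
  change x.vertex _ = φ (x.vertex _)
  rw [hx]
  congr 1
  push_cast
  omega

theorem boundaryFixedPoints_inv (φ : T ≃g T) :
    boundaryFixedPoints φ⁻¹ = boundaryFixedPoints φ := by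
  have key : ∀ ψ : T ≃g T, boundaryFixedPoints ψ ⊆ boundaryFixedPoints ψ⁻¹ := by
    intro ψ ξ
    induction ξ using Quotient.inductionOn with
    | h x =>
      intro h
      obtain ⟨a, b, hab⟩ := Quotient.exact h
      refine Quotient.sound ⟨b, a, fun n => ?_⟩
      have h' : x.vertex (n + a) = ψ (x.vertex (n + b)) := hab n
      change x.vertex (n + b) = ψ⁻¹ (x.vertex (n + a))
      rw [h']
      exact (RelIso.inv_apply_self ψ _).symm
  exact (key φ⁻¹).antisymm (key φ)

end Line

/-! ### Contraction of half-trees -/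

section Action

variable {V Γ : Type*} [Group Γ] {T : SimpleGraph V} {ρ : Γ →* (T ≃g T)}

theorem apply_inv_apply (ρ : Γ →* (T ≃g T)) (g : Γ) (v : V) : ρ g (ρ g⁻¹ v) = v := by
  rw [map_inv]
  exact RelIso.apply_inv_self _ _

theorem mul_apply (ρ : Γ →* (T ≃g T)) (g h : Γ) (v : V) : ρ (g * h) v = ρ g (ρ h v) := by
  rw [map_mul, RelIso.mul_apply]

/-- Some element of the subgroup `M` is such that all its positive powers send the complement of
`B` into `B`. -/
def ContractsInto (ρ : Γ →* (T ≃g T)) (M : Subgroup Γ) (B : Set V) : Prop :=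
  ∃ g ∈ M, ∀ k : ℕ, 1 ≤ k → ∀ v ∉ B, ρ (g ^ k) v ∈ B

theorem ContractsInto.mono {M : Subgroup Γ} {B B' : Set V} (h : ContractsInto ρ M B)
    (hB : B ⊆ B') : ContractsInto ρ M B' := by
  obtain ⟨g, hg, h⟩ := h
  exact ⟨g, hg, fun k hk v hv => hB (h k hk v fun hv' => hv (hB hv'))⟩

/-- The passage to a normal subgroup `H` of `K`. If `m ∈ K` contracts into `B`, and if `n ∈ H`
moves `B` off itself, then by a ping-pong argument `m n m⁻² n⁻¹ m`, which is conjugate to a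
commutator of `n` and a power of `m`, contracts into `B`. -/
theorem ContractsInto.of_normal {H K : Subgroup Γ} (hHK : H ≤ K) (hN : (H.subgroupOf K).Normal)
    {B : Set V} (h : ContractsInto ρ K B) {n : Γ} (hn : n ∈ H)
    (hB : ∀ v ∈ B, ρ n v ∉ B) : ContractsInto ρ H B := by
  obtain ⟨m, hm, h⟩ := h
  have hm1 : ∀ v ∉ B, ρ m v ∈ B := by simpa using h 1 le_rfl
  have hm2 : ∀ v ∉ B, ρ m (ρ m v) ∈ B := by
    intro v hv
    simpa [pow_two, mul_apply] using h 2 (by norm_num) v hv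
  have hm2' : ∀ v ∉ B, ρ (m ^ 2)⁻¹ v ∈ B := by
    intro v hv
    by_contra h'
    have := h 2 (by norm_num) _ h'
    rw [apply_inv_apply] at this
    exact hv this
  have hn' : ∀ v ∈ B, ρ n⁻¹ v ∉ B := by
    intro v hv h'
    have := hB _ h'
    rw [apply_inv_apply] at this
    exact this hv
  have hconj := (Subgroup.normal_subgroupOf_iff hHK).1 hN
  refine ⟨m * n * (m ^ 2)⁻¹ * n⁻¹ * m, ?_, ?_⟩
  · have h1 := hconj n (m ^ 1) hn (K.pow_mem hm 1)
    have h2 := hconj n⁻¹ m⁻¹ (H.inv_mem hn) (K.inv_mem hm)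
    have h3 := H.mul_mem h1 h2
    convert h3 using 1
    group
  · -- The invariant `ρ m v ∈ B` holds for `v ∉ B` and for `v ∈ m Bᶜ`.
    have key : ∀ v, ρ m v ∈ B → ρ (m * n * (m ^ 2)⁻¹ * n⁻¹ * m) v ∈ B ∧
        ρ m (ρ (m * n * (m ^ 2)⁻¹ * n⁻¹ * m) v) ∈ B := by
      intro v hv
      have hw := hB _ (hm2' _ (hn' _ hv))
      simp only [mul_apply]
      exact ⟨hm1 _ hw, hm2 _ hw⟩
    have key' : ∀ k : ℕ, ∀ v, ρ m v ∈ B → ρ ((m * n * (m ^ 2)⁻¹ * n⁻¹ * m) ^ (k + 1)) v ∈ B ∧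
        ρ m (ρ ((m * n * (m ^ 2)⁻¹ * n⁻¹ * m) ^ (k + 1)) v) ∈ B := by
      intro k
      induction k with
      | zero => simpa using key
      | succ k ih =>
        intro v hv
        rw [pow_succ', mul_apply]
        exact key _ (ih v hv).2
    intro k hk v hv
    obtain ⟨k, rfl⟩ := Nat.exists_eq_add_of_le' hk
    exact (key' k v (hm1 v hv)).1

/-! ### Minimal and strongly hyperbolic actions -/

/-- For a minimal action, every orbit meets every half-tree: the vertices without translate in the
half-tree span an invariant subtree. -/
theorem IsMinimalAction.exists_apply_mem_halfTree (hT : T.IsTree) (hmin : IsMinimalAction ρ)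
    (v : V) {s t : V} (hst : T.Adj s t) : ∃ g, ρ g v ∈ halfTree T s t := by
  by_contra! hv
  let W : Set V := {u | ∀ g, ρ g u ∉ halfTree T s t}
  let S : T.Subgraph := (⊤ : T.Subgraph).induce W
  have hconn : S.Connected := by
    have key : ∀ (n : ℕ) (u : V) (hu : u ∈ W), T.dist v u = n →
        S.coe.Reachable ⟨u, hu⟩ ⟨v, hv⟩ := by
      intro n
      induction n with
      | zero =>
        intro u hu hd
        have := (hT.connected.dist_eq_zero_iff).1 hd
        subst this
        exact Reachable.refl _
      | succ n ih =>
        intro u hu hd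
        have hne : u ≠ v := by
          rintro rfl
          simp at hd
        obtain ⟨w, hw, hd'⟩ := exists_adj_dist_eq hT hne
        have hwW : w ∈ W := fun g =>
          notMem_halfTree_of_dist_eq hT hst (hv g) (hu g) ((ρ g).map_adj_iff.2 hw)
            (by rw [dist_iso, dist_iso, hd'])
        have hadj : S.coe.Adj ⟨u, hu⟩ ⟨w, hwW⟩ := ⟨hu, hwW, hw⟩
        exact hadj.reachable.trans (ih w hwW (by omega))
    rw [Subgraph.connected_iff', connected_iff]
    exact ⟨fun a b => (key _ a.1 a.2 rfl).trans (key _ b.1 b.2 rfl).symm, ⟨⟨v, hv⟩⟩⟩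
  have hWinv : ∀ g, ∀ u ∈ W, ρ g u ∈ W := by
    intro g u hu k
    rw [← mul_apply]
    exact hu _
  have hinv : ∀ g : Γ, S.map (ρ g).toHom = S := by
    intro g
    ext a b
    · constructor
      · rintro ⟨u, hu, rfl⟩
        exact hWinv g u hu
      · intro ha
        exact ⟨ρ g⁻¹ a, hWinv _ _ ha, apply_inv_apply ρ g a⟩
    · constructor
      · rintro ⟨u, w, ⟨hu, hw, huw⟩, rfl, rfl⟩
        exact ⟨hWinv g u hu, hWinv g w hw, (ρ g).map_adj_iff.2 huw⟩
      · rintro ⟨ha, hb, hab⟩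
        exact ⟨ρ g⁻¹ a, ρ g⁻¹ b, ⟨hWinv _ _ ha, hWinv _ _ hb, (ρ g⁻¹).map_adj_iff.2 hab⟩,
          apply_inv_apply ρ g a, apply_inv_apply ρ g b⟩
  have htop := hmin S hconn hinv
  have ht : t ∈ S.verts := by
    rw [htop]
    trivial
  exact ht 1 (by simpa using snd_mem_halfTree hst)

/-- A half-tree which contains a vertex of a line contains one of the two ends of the line. -/
theorem Line.exists_halfTree_subset (hT : T.IsTree) (x : Line T) {s t : V} (hst : T.Adj s t)
    (h0 : x.vertex 0 ∈ halfTree T s t) :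
    ∃ M : ℕ, halfTree T (x.vertex M) (x.vertex (M + 1)) ⊆ halfTree T s t ∨
      halfTree T (x.reverse.vertex M) (x.reverse.vertex (M + 1)) ⊆ halfTree T s t := by
  refine ⟨T.dist (x.vertex 0) s, ?_⟩
  set M := T.dist (x.vertex 0) s with hM
  by_contra! h
  have key : ∀ y : Line T, y.vertex 0 = x.vertex 0 →
      ¬ halfTree T (y.vertex M) (y.vertex (M + 1)) ⊆ halfTree T s t →
      y.vertex (M + 1) ∉ halfTree T s t := by
    intro y hy hsub hmem
    refine hsub (halfTree_subset_halfTree hT hst (y.adj M) ?_ hmem)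
    exact y.toRay.notMem_halfTree hT (n := M) (by
      change T.dist (y.vertex 0) s ≤ M
      rw [hy])
  have h1 := key x rfl h.1
  have h2 := key x.reverse (by simp [reverse]) h.2
  -- By convexity the whole segment between the two vertices avoids the half-tree.
  have h3 : ∀ k : ℕ, x.vertex (M + 1 - k) ∉ halfTree T s t ∨ (2 * M + 2 < k) := by
    intro k
    induction k with
    | zero => left; simpa using h1
    | succ k ih =>
      rcases ih with ih | ih
      · by_cases hk : 2 * M + 2 < k + 1
        · exact Or.inr hk
        left
        have hadj := x.adj (M + 1 - (k + 1 : ℕ))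
        rw [show (M + 1 - (k + 1 : ℕ) + 1 : ℤ) = M + 1 - k by push_cast; ring] at hadj
        refine notMem_halfTree_of_dist_eq hT hst h2 ih hadj.symm ?_
        have e1 := x.dist_eq (-(M + 1)) (M + 1 - k)
        have e2 := x.dist_eq (-(M + 1)) (M + 1 - (k + 1 : ℕ))
        rw [abs_of_nonpos (by omega)] at e1 e2
        change T.dist (x.vertex (-(M + 1))) _ = T.dist (x.vertex (-(M + 1))) _ + 1
        omega
      · right; omega
  rcases h3 (M + 1) with h3 | h3
  · exact h3 (by simpa using h0)
  · omega

/-- The attracting ends of two translations without common fixed point at infinity have disjoint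
neighbourhoods. -/
theorem disjoint_halfTree_far_out (hT : T.IsTree) {φ ψ : T ≃g T} {x y : Line T} {a b : ℤ}
    (ha : 1 ≤ a) (hb : 1 ≤ b) (hx : ∀ i, φ (x.vertex i) = x.vertex (i + a))
    (hy : ∀ i, ψ (y.vertex i) = y.vertex (i + b))
    (hdisj : Disjoint (boundaryFixedPoints φ) (boundaryFixedPoints ψ)) :
    ∃ N : ℕ, ∀ n : ℕ, N ≤ n → Disjoint (halfTree T (x.vertex n) (x.vertex (n + 1)))
      (halfTree T (y.vertex n) (y.vertex (n + 1))) :=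
  x.toRay.exists_disjoint_halfTree hT y.toRay fun h =>
    Set.disjoint_left.1 hdisj (Line.toBoundary_mem_boundaryFixedPoints ha hx)
      (h ▸ Line.toBoundary_mem_boundaryFixedPoints hb hy)

theorem Line.notMem_reverse_iff (hT : T.IsTree) (x : Line T) {n : ℕ} {v : V} :
    v ∉ halfTree T (x.reverse.vertex n) (x.reverse.vertex (n + 1)) ↔
      v ∈ halfTree T (x.vertex (-n - 1)) (x.vertex (-n - 1 + 1)) := by
  rw [notMem_halfTree_iff hT (x.reverse.adj n), sub_add_cancel]
  change v ∈ halfTree T (x.vertex (-(n + 1))) (x.vertex (-n)) ↔ _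
  rw [neg_add, sub_eq_add_neg]

/-- A translation of a line sends whatever avoids the repelling end into any given neighbourhood
of the attracting end. -/
theorem Line.exists_pow_apply_mem (hT : T.IsTree) {φ : T ≃g T} {x : Line T} {a : ℤ}
    (ha : 1 ≤ a) (hx : ∀ i, φ (x.vertex i) = x.vertex (i + a)) {n M k : ℕ}
    (hk : n + M + 1 ≤ k) {v : V}
    (hv : v ∉ halfTree T (x.reverse.vertex n) (x.reverse.vertex (n + 1))) :
    (φ ^ k) v ∈ halfTree T (x.vertex M) (x.vertex (M + 1)) :=
  pow_apply_mem_halfTree hT ha hx (by omega) ((x.notMem_reverse_iff hT).1 hv)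

/-- The base of the argument: the group contracts into every half-tree. One of the two transverse
hyperbolic elements contracts into the union of small neighbourhoods of its two ends, and the
other one, together with minimality, moves this union into the given half-tree. -/
theorem contractsInto_halfTree (hT : T.IsTree) (hhyp : IsStronglyHyperbolicAction ρ)
    (hmin : IsMinimalAction ρ) {s t : V} (hst : T.Adj s t) :
    ContractsInto ρ ⊤ (halfTree T s t) := by
  obtain ⟨γ, δ, hγ, hδ, hdisj⟩ := hhyp
  obtain ⟨x, a, ha, hx⟩ := hγ.exists_line hT
  obtain ⟨y, b, hb, hy⟩ := hδ.exists_line hT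
  have hx' := Line.reverse_apply hx
  have hy' := Line.reverse_apply hy
  have hdx := boundaryFixedPoints_inv (ρ γ)
  have hdy := boundaryFixedPoints_inv (ρ δ)
  obtain ⟨N₁, h₁⟩ := disjoint_halfTree_far_out hT ha hb hx hy hdisj
  obtain ⟨N₂, h₂⟩ := disjoint_halfTree_far_out hT ha hb hx hy' (by rwa [hdy])
  obtain ⟨N₃, h₃⟩ := disjoint_halfTree_far_out hT ha hb hx' hy (by rwa [hdx])
  obtain ⟨N₄, h₄⟩ := disjoint_halfTree_far_out hT ha hb hx' hy' (by rwa [hdx, hdy])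
  obtain ⟨n, hn₁, hn₂, hn₃, hn₄⟩ : ∃ n, N₁ ≤ n ∧ N₂ ≤ n ∧ N₃ ≤ n ∧ N₄ ≤ n :=
    ⟨N₁ + N₂ + N₃ + N₄, by omega, by omega, by omega, by omega⟩
  replace h₁ := h₁ n hn₁
  replace h₂ := h₂ n hn₂
  replace h₃ := h₃ n hn₃
  replace h₄ := h₄ n hn₄
  set B : Set V := halfTree T (y.vertex n) (y.vertex (n + 1)) ∪
    halfTree T (y.reverse.vertex n) (y.reverse.vertex (n + 1)) with hB
  have hcontr : ∀ k : ℕ, 1 ≤ k → ∀ v ∉ B, ρ ((δ ^ (n + n + 1)) ^ k) v ∈ B := by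
    intro k hk v hv
    rw [← pow_mul, map_pow]
    exact Or.inl (Line.exists_pow_apply_mem hT hb hy (n := n) (Nat.le_mul_of_pos_right _ hk)
      fun h => hv (Or.inr h))
  suffices h : ∃ c, ∀ v ∈ B, ρ c v ∈ halfTree T s t by
    obtain ⟨c, hc⟩ := h
    refine ⟨c * δ ^ (n + n + 1) * c⁻¹, trivial, fun k hk v hv => ?_⟩
    rw [conj_pow, mul_apply, mul_apply]
    refine hc _ (hcontr k hk _ fun h => hv ?_)
    simpa [apply_inv_apply] using hc _ h
  obtain ⟨d, hd⟩ := hmin.exists_apply_mem_halfTree hT (x.vertex 0) hst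
  have hiff : ∀ v, v ∈ halfTree T (ρ d⁻¹ s) (ρ d⁻¹ t) ↔ ρ d v ∈ halfTree T s t := by
    intro v
    rw [← apply_mem_halfTree_iff (ρ d), apply_inv_apply, apply_inv_apply]
  obtain ⟨M, hM | hM⟩ := x.exists_halfTree_subset hT ((ρ d⁻¹).map_adj_iff.2 hst) ((hiff _).2 hd)
  · refine ⟨d * γ ^ (n + M + 1), fun v hv => ?_⟩
    rw [mul_apply, map_pow, ← hiff]
    refine hM (Line.exists_pow_apply_mem hT ha hx le_rfl fun h => ?_)
    exact hv.elim (Set.disjoint_left.1 h₃ h) (Set.disjoint_left.1 h₄ h)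
  · refine ⟨d * γ⁻¹ ^ (n + M + 1), fun v hv => ?_⟩
    rw [mul_apply, map_pow, ← hiff, map_inv ρ γ]
    refine hM (Line.exists_pow_apply_mem hT ha hx' (n := n) le_rfl fun h => ?_)
    have hrr : x.reverse.reverse = x := by simp [Line.reverse]
    rw [hrr] at h
    exact hv.elim (Set.disjoint_left.1 h₁ h) (Set.disjoint_left.1 h₂ h)

/-! ### Slender actions -/

theorem Ray.toBoundary_mem_shadow (x : Ray T) (n : ℕ) :
    x.toBoundary ∈ shadow ⟨(x.vertex n, x.vertex (n + 1)), x.adj n⟩ :=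
  ⟨x, rfl, Filter.eventually_atTop.2 ⟨n + 1, fun _ hm => x.mem_halfTree_iff.2 hm⟩⟩

/-- A slender automorphism moves some smaller half-tree off itself. -/
theorem IsSlender.exists_halfTree (hT : T.IsTree) {φ : T ≃g T} (hφ : IsSlender φ) (e : T.Dart)
    (he : (shadow e).Nonempty) :
    ∃ e' : T.Dart, (shadow e').Nonempty ∧ halfTree T e'.fst e'.snd ⊆ halfTree T e.fst e.snd ∧
      ∀ v ∈ halfTree T e'.fst e'.snd, φ v ∉ halfTree T e'.fst e'.snd := by
  obtain ⟨ξ, hξ, hfix⟩ : ∃ ξ ∈ shadow e, boundaryMap φ ξ ≠ ξ := by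
    by_contra! h
    have hopen : IsOpen (shadow e) := TopologicalSpace.isOpen_generateFrom_of_mem ⟨e, rfl⟩
    have hsub := interior_maximal (show shadow e ⊆ boundaryFixedPoints φ from h) hopen
    rw [show interior (boundaryFixedPoints φ) = ∅ from hφ] at hsub
    exact he.ne_empty (Set.subset_empty_iff.1 hsub)
  obtain ⟨x, rfl, hx⟩ := hξ
  obtain ⟨m, hm⟩ := Filter.eventually_atTop.1 hx
  obtain ⟨N, hN⟩ := Ray.exists_disjoint_halfTree hT (Ray.map φ x) x hfix
  set n := m + N + T.dist (x.vertex 0) e.fst with hn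
  refine ⟨⟨(x.vertex n, x.vertex (n + 1)), x.adj n⟩, ⟨_, x.toBoundary_mem_shadow n⟩, ?_, ?_⟩
  · exact halfTree_subset_halfTree hT e.adj (x.adj n) (x.notMem_halfTree hT (by omega))
      (hm _ (by omega))
  · intro v hv
    exact Set.disjoint_left.1 (hN n (by omega)) ((apply_mem_halfTree_iff φ).2 hv)

theorem IsSlenderAction.exists_halfTree (hT : T.IsTree) (hslender : IsSlenderAction ρ)
    (F : Finset Γ) (hF : (1 : Γ) ∉ F) (e : T.Dart) (he : (shadow e).Nonempty) :
    ∃ e' : T.Dart, (shadow e').Nonempty ∧ halfTree T e'.fst e'.snd ⊆ halfTree T e.fst e.snd ∧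
      ∀ f ∈ F, ∀ v ∈ halfTree T e'.fst e'.snd, ρ f v ∉ halfTree T e'.fst e'.snd := by
  classical
  induction F using Finset.induction_on with
  | empty => exact ⟨e, he, subset_rfl, by simp⟩
  | insert f F _ ih =>
    rw [Finset.mem_insert, not_or] at hF
    obtain ⟨e₁, he₁, hsub₁, h₁⟩ := ih hF.2
    obtain ⟨e₂, he₂, hsub₂, h₂⟩ := (hslender f (Ne.symm hF.1)).exists_halfTree hT e₁ he₁
    refine ⟨e₂, he₂, hsub₂.trans hsub₁, ?_⟩
    intro k hk v hv
    rcases Finset.mem_insert.1 hk with rfl | hk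
    · exact h₂ v hv
    · exact fun h => h₁ k hk v (hsub₂ hv) (hsub₂ h)

/-- Non-trivial subnormal subgroups contract into the half-trees of non-empty shadow. -/
theorem contractsInto_of_isSubnormal (hT : T.IsTree) (hslender : IsSlenderAction ρ)
    (hhyp : IsStronglyHyperbolicAction ρ) (hmin : IsMinimalAction ρ) {N : Subgroup Γ}
    (hN : N.IsSubnormal) (hne : N ≠ ⊥) (e : T.Dart) (he : (shadow e).Nonempty) :
    ContractsInto ρ N (halfTree T e.fst e.snd) := by
  induction hN generalizing e with
  | top => exact contractsInto_halfTree hT hhyp hmin e.adj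
  | step H K hle _ hnorm ih =>
    obtain ⟨n, hn, hn1⟩ := H.bot_or_exists_ne_one.resolve_left hne
    obtain ⟨e', he', hsub, hdisj⟩ := (hslender n hn1).exists_halfTree hT e he
    exact ((ih (ne_bot_of_le_ne_bot hne hle) e' he').of_normal hle hnorm hn hdisj).mono hsub

/-! ### The Powers property -/

/-- The partition of the subgroup is given by the position of the orbit of `v₀` with respect to
`B`, and the translations by the powers of a contracting element. -/
theorem isPowersGroup_of_contractsInto {N : Subgroup Γ} (hN : N ≠ ⊥)
    (h : ∀ F : Finset Γ, (1 : Γ) ∉ F → ∃ B : Set V, ContractsInto ρ N B ∧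
      ∀ f ∈ F, ∀ v ∈ B, ρ f v ∉ B) (v₀ : V) : IsPowersGroup N := by
  classical
  refine ⟨(Subgroup.nontrivial_iff_ne_bot N).2 hN, fun F hF n _ => ?_⟩
  obtain ⟨B, ⟨g, hg, hgB⟩, hFB⟩ := h (F.image N.subtype) (by simpa using hF)
  let D : Set N := {k | ρ k v₀ ∉ B}
  refine ⟨Dᶜ, D, fun j => ⟨g, hg⟩ ^ (j : ℕ), Set.compl_union_self D, Set.compl_inter_self D, ?_, ?_⟩
  · intro f hf
    rw [Set.eq_empty_iff_forall_notMem]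
    rintro _ ⟨⟨k, hk, rfl⟩, hfk⟩
    have hk' : ρ k v₀ ∈ B := not_not.1 hk
    have hfk' : ρ (f * k : Γ) v₀ ∈ B := not_not.1 hfk
    rw [mul_apply] at hfk'
    exact hFB f (Finset.mem_image_of_mem _ hf) _ hk' hfk'
  · have key : ∀ i j : ℕ, i < j → ∀ d ∈ D, ∀ d' ∈ D,
        (⟨g, hg⟩ : N) ^ i * d ≠ (⟨g, hg⟩ : N) ^ j * d' := by
      intro i j hij d hd d' hd' heq
      obtain ⟨k, rfl⟩ := Nat.exists_eq_add_of_lt hij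
      rw [add_assoc, pow_add, mul_assoc, mul_left_cancel_iff] at heq
      apply hd
      rw [heq]
      have := hgB (k + 1) (by omega) _ hd'
      rw [← mul_apply] at this
      simpa using this
    intro i j hij
    rw [Set.eq_empty_iff_forall_notMem]
    rintro _ ⟨⟨d, hd, rfl⟩, ⟨d', hd', h'⟩⟩
    have hij' : (i : ℕ) ≠ j := fun h => hij (Fin.ext h)
    rcases hij'.lt_or_gt with hlt | hlt
    · exact key i j hlt d hd d' hd' h'.symm
    · exact key j i hlt d' hd' d hd h'

end Action

end TreeAction

theorem proposition2p7 {Γ V : Type*} [Group Γ] [Countable Γ]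
    (T : SimpleGraph V) (hT : T.IsTree) (ρ : Γ →* (T ≃g T))
    (hslender : TreeAction.IsSlenderAction ρ)
    (hhyp : TreeAction.IsStronglyHyperbolicAction ρ)
    (hmin : TreeAction.IsMinimalAction ρ) :
    TreeAction.IsStronglyPowersGroup Γ := by
  intro N hN hne
  obtain ⟨_, -, hγ, -⟩ := id hhyp
  obtain ⟨x, -⟩ := hγ.exists_line hT
  refine TreeAction.isPowersGroup_of_contractsInto (ρ := ρ) hne (fun F hF => ?_) (x.vertex 0)
  obtain ⟨e, he, -, hFe⟩ := hslender.exists_halfTree hT F hF _ ⟨_, x.toRay.toBoundary_mem_shadow 0⟩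
  exact ⟨_, TreeAction.contractsInto_of_isSubnormal hT hslender hhyp hmin hN hne e he, hFe⟩
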